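/- **Proposition (the Gaussian shift and Brownian drift experiments are Le Cam equivalent).** Let $k\in\mathbb N$, let $\Upsilon$ be a real vector space (typically separable and infinite-dimensional), and let information quantities be given: a matrix $\mathcal I_{I,I}\in\mathbb R^{k\times k}$, vectors $\mathcal I_{I,\eta}\in\mathbb R^k$ and scalars $\mathcal I_{\eta\eta'}$ ($\eta,\eta'\in\Upsilon$), with $\mathcal I_{I,0}=0$ and $\mathcal I_{0\eta'}=0$ for all $\eta'$, such that for all $\ell$ and all $\eta_1,\dots,\eta_\ell\in\Upsilon$ the $(k+\ell)\times(k+\ell)$ matrix $$\mathcal I_{\eta_1,\dots,\eta_\ell}=\begin{pmatrix}\mathcal I_{I,I}&\mathcal I_{I,\eta_1}&\cdots&\mathcal I_{I,\eta_\ell}\\ \mathcal I_{I,\eta_1}^\top&\mathcal I_{\eta_1\eta_1}&\cdots&\mathcal I_{\eta_1\eta_\ell}\\ \vdots&&&\vdots\\ \mathcal I_{I,\eta_\ell}^\top&\mathcal I_{\eta_\ell\eta_1}&\cdots&\mathcal I_{\eta_\ell\eta_\ell}\end{pmatrix}$$ is symmetric and positive semidefinite. For a local parameter $(\tau,\eta)\in\mathbb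 R^k\times\Upsilon$ put $$m_{\tau,\eta}(\eta_1,\dots,\eta_\ell)=\big(\mathcal I_{I,I}\tau+\mathcal I_{I,\eta},\ \mathcal I_{I,\eta_1}^\top\tau+\mathcal I_{\eta_1\eta},\ \dots,\ \mathcal I_{I,\eta_\ell}^\top\tau+\mathcal I_{\eta_\ell\eta}\big)^\top .$$ * The *Gaussian shift experiment* $\mathcal E_{\rm shift}$ has as observation the family of random variables $\Delta_{\rm int}=(\Delta_{{\rm int},1},\dots,\Delta_{{\rm int},k})$, $\{\Delta_{{\rm nuis},\eta'}:\eta'\in\Upsilon\}$ (with the $\sigma$-field generated by the coordinates) such that, under $\mathbb P_{\tau,\eta}$, each vector $(\Delta_{\rm int},\Delta_{{\rm nuis},\eta_1},\dots,\Delta_{{\rm nuis},\eta_\ell})$ is $\mathcal N\big(m_{\tau,\eta}(\eta_1,\dots,\eta_\ell),\mathcal I_{\eta_1,\dots,\eta_\ell}\big)$. * The *Brownian drift experiment* $\mathcal E_{\rm drift}$ has as observation a family of continuous processes $\Delta_{\rm int}(u)\in\mathbb R^k$, $\{\Delta_{{\rm nuis},\eta'}(u):\eta'\in\Upsilon\}$,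 $u\in[0,1]$ (with the $\sigma$-field generated by the evaluations) such that, under $\mathbb P_{\tau,\eta}$, each process $(\Delta_{\rm int}(u),\Delta_{{\rm nuis},\eta_1}(u),\dots,\Delta_{{\rm nuis},\eta_\ell}(u))_{u\in[0,1]}$ is a multivariate Brownian motion started at $0$ with drift $m_{\tau,\eta}(\eta_1,\dots,\eta_\ell)$ and covariance matrix $\mathcal I_{\eta_1,\dots,\eta_\ell}$ per unit of time. Then $\mathcal E_{\rm shift}$ and $\mathcal E_{\rm drift}$ are equivalent in the sense of the Le Cam distance: $\max\{\delta(\mathcal E_{\rm shift},\mathcal E_{\rm drift}),\delta(\mathcal E_{\rm drift},\mathcal E_{\rm shift})\}=0$, where $\delta(\mathcal E,\mathcal F)=\inf_T\sup_{\tau,\eta}\tfrac12\|T\mathbb P^{\mathcal E}_{\tau,\eta}-\mathbb P^{\mathcal F}_{\tau,\eta}\|_{TV}$ with $\|\cdot\|_{TV}$ the total variation norm, the infimum being over all transitions $T$ (positive linear maps between the spaces of finite signed measures on the two observation spaces that preserve total mass). Moreover, for all $n$ and all $(\tau_1,\eta_1),\dots,(\tau_n,\eta_n)\in\mathbb R^k\times\Upsilon$,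 the joint distribution under $\mathbb P_{0,0}$ of the log-likelihood ratios $\big(\log(d\mathbb P_{\tau_i,\eta_i}/d\mathbb P_{0,0})\big)_{i=1,\dots,n}$ is the same in $\mathcal E_{\rm shift}$ and in $\mathcal E_{\rm drift}$. -/

import Mathlib

open MeasureTheory ProbabilityTheory Matrix
open scoped ENNReal NNReal

noncomputable section

/-! ## Statistical experiments and the Le Cam distance -/

/-- A statistical experiment with parameter set `Θ` and observation space `𝒳` (a set with a
σ-field): a family of probability measures on `𝒳` indexed by `Θ`. -/
abbrev Experiment (Θ 𝒳 : Type*) [MeasurableSpace 𝒳] : Type _ := Θ → ProbabilityMeasure 𝒳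

/-- The total variation distance `(1/2) ‖μ - ν‖` of two finite measures. -/
def tvDistance {𝒴 : Type*} [MeasurableSpace 𝒴] (μ ν : FiniteMeasure 𝒴) : ℝ≥0∞ :=
  ((μ : Measure 𝒴).toSignedMeasure - (ν : Measure 𝒴).toSignedMeasure).totalVariation Set.univ / 2

/-- A transition (randomization in the sense of Le Cam) from `𝒳` to `𝒴`: a positive linear map
from the finite signed measures on `𝒳` to those on `𝒴` that preserves the total mass. Since every
finite signed measure is a difference of two finite measures, such a map is the same thing as its
restriction to the positive cones, an additive and positively homogeneous map between finite
measures; this restriction is the datum recorded here. Every Markov kernel `κ` from `𝒳` to `𝒴`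
gives the transition `μ ↦ κ ∘ μ`. -/
structure Transition (𝒳 𝒴 : Type*) [MeasurableSpace 𝒳] [MeasurableSpace 𝒴] where
  /-- The map on finite measures. -/
  toLinearMap : FiniteMeasure 𝒳 →ₗ[ℝ≥0] FiniteMeasure 𝒴
  /-- Total masses are preserved. -/
  mass_map : ∀ μ : FiniteMeasure 𝒳, (toLinearMap μ).mass = μ.mass

/-- The deficiency `δ(E, F) = inf_T sup_θ ‖T E_θ - F_θ‖` of `E` with respect to `F`, the infimum
being over all transitions `T`. -/
def deficiency {Θ 𝒳 𝒴 : Type*} [MeasurableSpace 𝒳] [MeasurableSpace 𝒴]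
    (E : Experiment Θ 𝒳) (F : Experiment Θ 𝒴) : ℝ≥0∞ :=
  ⨅ T : Transition 𝒳 𝒴, ⨆ θ : Θ,
    tvDistance (T.toLinearMap (E θ).toFiniteMeasure) (F θ).toFiniteMeasure

/-- The Le Cam (pseudo-)distance between two experiments with the same parameter set. -/
def leCamDist {Θ 𝒳 𝒴 : Type*} [MeasurableSpace 𝒳] [MeasurableSpace 𝒴]
    (E : Experiment Θ 𝒳) (F : Experiment Θ 𝒴) : ℝ≥0∞ :=
  max (deficiency E F) (deficiency F E)

/-- The joint law under `E θ₀` of the tuple of log-likelihood ratios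
`log (dE_{θ 1} / dE_{θ₀}), …, log (dE_{θ n} / dE_{θ₀})`. -/
def llrLaw {Θ 𝒳 : Type*} [MeasurableSpace 𝒳] (E : Experiment Θ 𝒳) (θ₀ : Θ) {n : ℕ}
    (θ : Fin n → Θ) : Measure (Fin n → ℝ) :=
  (E θ₀ : Measure 𝒳).map (fun x i => llr (E (θ i) : Measure 𝒳) (E θ₀ : Measure 𝒳) x)

/-! ## The information quantities -/

/-- The information quantities for a `k`-dimensional parameter of interest and a nuisance parameter
ranging over the vector space `Υ`: the `k × k` matrix `int = 𝓘_{I,I}`, the vectors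
`cross η = 𝓘_{I,η} ∈ ℝᵏ` and the scalars `nuis η η' = 𝓘_{ηη'}`. -/
structure Information (k : ℕ) (Υ : Type*) where
  /-- The information matrix `𝓘_{I,I}` of the parameter of interest. -/
  int : Matrix (Fin k) (Fin k) ℝ
  /-- The cross-information vectors `𝓘_{I,η}`. -/
  cross : Υ → Fin k → ℝ
  /-- The scalar information and cross-information quantities `𝓘_{ηη'}`. -/
  nuis : Υ → Υ → ℝ

namespace Information

variable {k : ℕ} {Υ : Type*} (𝓘 : Information k Υ)

/-- The `(k + ℓ) × (k + ℓ)` matrix `𝓘_{η₁,…,η_ℓ}`. -/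
def cov {ℓ : ℕ} (η : Fin ℓ → Υ) : Matrix (Fin k ⊕ Fin ℓ) (Fin k ⊕ Fin ℓ) ℝ :=
  Matrix.fromBlocks 𝓘.int (Matrix.of fun i b => 𝓘.cross (η b) i)
    (Matrix.of fun a j => 𝓘.cross (η a) j) (Matrix.of fun a b => 𝓘.nuis (η a) (η b))

/-- The location at the local parameter value `(τ, η)` of the components of interest and of the
nuisance components `η₁, …, η_ℓ`: the vector with blocks `𝓘_{I,I} τ + 𝓘_{I,η}` and
`𝓘_{I,η_a}ᵀ τ + 𝓘_{η_a η}`. -/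
def mean (τ : Fin k → ℝ) (η : Υ) {ℓ : ℕ} (ηs : Fin ℓ → Υ) :
    EuclideanSpace ℝ (Fin k ⊕ Fin ℓ) :=
  WithLp.toLp 2 (Sum.elim (𝓘.int *ᵥ τ + 𝓘.cross η)
    (fun a => 𝓘.cross (ηs a) ⬝ᵥ τ + 𝓘.nuis (ηs a) η))

/-- The information quantities are admissible: the quantities attached to the origin of `Υ` vanish,
and all the matrices `𝓘_{η₁,…,η_ℓ}` are covariance matrices. -/
structure IsAdmissible [Zero Υ] : Prop where
  cross_zero : 𝓘.cross 0 = 0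
  nuis_zero : ∀ η, 𝓘.nuis 0 η = 0
  posSemidef : ∀ (ℓ : ℕ) (η : Fin ℓ → Υ), (𝓘.cov η).PosSemidef

end Information

/-! ## The Gaussian shift and the Brownian drift experiments -/

/-- The set of local parameters `(τ, η)`. -/
abbrev LocalParam (k : ℕ) (Υ : Type*) : Type _ := (Fin k → ℝ) × Υ

/-- The observation space of the Gaussian shift experiment: an observation consists of the reals
`Δ_{int,1}, …, Δ_{int,k}` and `Δ_{nuis,η}`, `η ∈ Υ`; the σ-field is the one generated by the
coordinates. -/
abbrev ShiftSpace (k : ℕ) (Υ : Type*) : Type _ := Fin k ⊕ Υ → ℝ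

/-- The observation space of the Brownian drift experiment: an observation consists of the
continuous paths `u ↦ Δ_{int,i}(u)`, `i = 1, …, k`, and `u ↦ Δ_{nuis,η}(u)`, `η ∈ Υ`, for
`u ∈ [0,1]`; the σ-field is the one generated by the evaluations of these paths. -/
abbrev DriftSpace (k : ℕ) (Υ : Type*) : Type _ :=
  {ω : Fin k ⊕ Υ → unitInterval → ℝ // ∀ c, Continuous (ω c)}

/-- The finite-dimensional vector `(x_{int,1}, …, x_{int,k}, x_{nuis,η₁}, …, x_{nuis,η_ℓ})`. -/
def marginal {k : ℕ} {Υ : Type*} {ℓ : ℕ} (η : Fin ℓ → Υ) (x : Fin k ⊕ Υ → ℝ) :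
    EuclideanSpace ℝ (Fin k ⊕ Fin ℓ) :=
  WithLp.toLp 2 (fun c => x (Sum.map id η c))

/-- `E` is the Gaussian shift experiment with information quantities `𝓘`: under `(τ, η)`, every
vector `(Δ_int, Δ_{nuis,η₁}, …, Δ_{nuis,η_ℓ})` is Gaussian with mean `𝓘.mean τ η` and covariance
matrix `𝓘_{η₁,…,η_ℓ}`. -/
def IsGaussianShift {k : ℕ} {Υ : Type*} (𝓘 : Information k Υ)
    (E : Experiment (LocalParam k Υ) (ShiftSpace k Υ)) : Prop :=
  ∀ (τ : Fin k → ℝ) (η : Υ) (ℓ : ℕ) (ηs : Fin ℓ → Υ),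
    HasLaw (marginal ηs) (multivariateGaussian (𝓘.mean τ η ηs) (𝓘.cov ηs)) (E (τ, η) : Measure _)

/-- `W` is under `P` a multivariate Brownian motion on `[0,1]`, started at `0`, with drift vector
`b` and covariance matrix `S` (per unit of time). -/
structure IsBrownianMotionWithDrift {Ω ι : Type*} [MeasurableSpace Ω] [Fintype ι] [DecidableEq ι]
    (W : unitInterval → Ω → EuclideanSpace ℝ ι) (b : EuclideanSpace ℝ ι) (S : Matrix ι ι ℝ)
    (P : Measure Ω) : Prop where
  start_zero : ∀ᵐ ω ∂P, W 0 ω = 0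
  indepIncrements : HasIndepIncrements W P
  hasLaw_increment : ∀ u v : unitInterval, u ≤ v →
    HasLaw (fun ω => W v ω - W u ω)
      (multivariateGaussian (((v : ℝ) - (u : ℝ)) • b) (((v : ℝ) - (u : ℝ)) • S)) P
  continuous_paths : ∀ᵐ ω ∂P, Continuous fun u => W u ω

/-- `F` is the Brownian drift experiment with information quantities `𝓘`: under `(τ, η)`, every
process `u ↦ (Δ_int(u), Δ_{nuis,η₁}(u), …, Δ_{nuis,η_ℓ}(u))` is a multivariate Brownian motion with
drift `𝓘.mean τ η` and covariance matrix `𝓘_{η₁,…,η_ℓ}`. -/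
def IsBrownianDrift {k : ℕ} {Υ : Type*} (𝓘 : Information k Υ)
    (F : Experiment (LocalParam k Υ) (DriftSpace k Υ)) : Prop :=
  ∀ (τ : Fin k → ℝ) (η : Υ) (ℓ : ℕ) (ηs : Fin ℓ → Υ),
    IsBrownianMotionWithDrift
      (fun u (ω : DriftSpace k Υ) => marginal ηs (fun c => ω.1 c u))
      (𝓘.mean τ η ηs) (𝓘.cov ηs) (F (τ, η) : Measure _)

end

/-! The endpoint of the drift experiment is a sufficient statistic, and what remains is ancillary.
For a path `W` with drift `m` and covariance `𝓘` per unit of time, the endpoint `W 1` is `N(m, 𝓘)`,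
which is the shift experiment. The bridge `W u - u * W 1` is Gaussian with mean `0` and covariance
`(min u v - u * v) * 𝓘`, whatever the local parameter.

Conversely, if `X` has the shift law and `B` is an independent bridge, then `u * X + B u` has mean
`u * m` and covariance `(u * v + (min u v - u * v)) * 𝓘 = min u v * 𝓘`. It is Gaussian, so by
`IsGaussianProcess.map_eq_of_mean_of_cov` it has the drift law; this is `map_addBridge_eq`. The
bridge is taken from the drift experiment at `(0, 0)`, so no Brownian motion has to be constructed.

The bridge vanishes at time `1`, so `endpoint` undoes `addBridge` exactly. Both deficiencies are
then zero (`leCamDist_eq_zero_of_randomizedMap`). Densities in the drift experiment are those of the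
shift experiment composed with `endpoint` (`rnDeriv_map_prod_comp`), so the log-likelihood ratios
agree in law without an explicit formula for them. -/

noncomputable section

/-! ### Gaussian processes -/

namespace ProbabilityTheory

variable {Ω Ω' T : Type*} [MeasurableSpace Ω] [MeasurableSpace Ω']

/-- Two real Gaussian processes with the same mean and covariance functions have the same law. -/
theorem IsGaussianProcess.map_eq_of_mean_of_cov {P : Measure Ω} {Q : Measure Ω'}
    {X : T → Ω → ℝ} {Y : T → Ω' → ℝ} (hX : IsGaussianProcess X P) (hY : IsGaussianProcess Y Q)
    (mX : ∀ t, Measurable (X t)) (mY : ∀ t, Measurable (Y t))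
    (hm : ∀ t, P[X t] = Q[Y t]) (hc : ∀ s t, cov[X s, X t; P] = cov[Y s, Y t; Q]) :
    P.map (fun ω t ↦ X t ω) = Q.map (fun ω t ↦ Y t ω) := by
  have hP := hX.isProbabilityMeasure
  have hQ := hY.isProbabilityMeasure
  have hX' : Measurable fun ω t ↦ X t ω := measurable_pi_lambda _ mX
  have hY' : Measurable fun ω t ↦ Y t ω := measurable_pi_lambda _ mY
  have hXI (I : Finset T) : Measurable fun ω ↦ I.restrict (X · ω) :=
    (Finset.measurable_restrict I).comp hX'
  have hYI (I : Finset T) : Measurable fun ω ↦ I.restrict (Y · ω) :=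
    (Finset.measurable_restrict I).comp hY'
  have (I : Finset T) : IsProbabilityMeasure (Q.map fun ω ↦ I.restrict (Y · ω)) :=
    Measure.isProbabilityMeasure_map (hYI I).aemeasurable
  -- Finite-dimensional laws determine a law on the product space.
  refine IsProjectiveLimit.unique (P := fun I : Finset T ↦ Q.map fun ω ↦ I.restrict (Y · ω))
    (fun I ↦ ?_) (fun I ↦ ?_)
  swap
  · rw [Measure.map_map (Finset.measurable_restrict I) hY']
    rfl
  rw [Measure.map_map (Finset.measurable_restrict I) hX']
  change P.map (fun ω ↦ I.restrict (X · ω)) = Q.map fun ω ↦ I.restrict (Y · ω)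
  -- Pass to the Euclidean space, whose inner product is needed for `covarianceBilin`.
  apply (MeasurableEquiv.toLp 2 (_ → ℝ)).map_measurableEquiv_injective
  rw [MeasurableEquiv.coe_toLp, ← PiLp.coe_symm_continuousLinearEquiv 2 ℝ]
  have h1 := (hX.hasGaussianLaw I).isGaussian_map
  have h2 := (hY.hasGaussianLaw I).isGaussian_map
  apply IsGaussian.ext
  · rw [integral_map, integral_map, integral_map, integral_map]
    · simp only [id_eq]
      rw [ContinuousLinearEquiv.integral_comp_comm, ContinuousLinearEquiv.integral_comp_comm]
      congr 1
      ext i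
      rw [eval_integral, eval_integral]
      · exact hm _
      · exact fun _ ↦ (hY.hasGaussianLaw_eval _).integrable
      · exact fun _ ↦ (hX.hasGaussianLaw_eval _).integrable
    any_goals fun_prop
    exacts [(hYI I).aemeasurable, (hXI I).aemeasurable]
  · rw [← ContinuousLinearMap.toBilinForm_inj]
    refine LinearMap.BilinForm.ext_of_isSymm isPosSemidef_covarianceBilin.isSymm
      isPosSemidef_covarianceBilin.isSymm fun x ↦ ?_
    simp only [ContinuousLinearMap.toBilinForm_apply]
    rw [PiLp.coe_symm_continuousLinearEquiv, covarianceBilin_apply_pi, covarianceBilin_apply_pi]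
    · congrm ∑ i, ∑ j, _ * ?_
      rw [covariance_map, covariance_map]
      · exact hc _ _
      any_goals exact Measurable.aestronglyMeasurable (by fun_prop)
      exacts [(hYI I).aemeasurable, (hXI I).aemeasurable]
    · exact fun i ↦ (h2.hasGaussianLaw_id.eval i).memLp_two
    · exact fun i ↦ (h1.hasGaussianLaw_id.eval i).memLp_two

/-- A Gaussian process composed with a measure preserving map is a Gaussian process. -/
theorem IsGaussianProcess.comp_measurePreserving {P : Measure Ω} {Q : Measure Ω'}
    {X : T → Ω → ℝ} (hX : IsGaussianProcess X P) {f : Ω' → Ω} (hf : MeasurePreserving f Q P) :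
    IsGaussianProcess (fun t ↦ X t ∘ f) Q where
  hasGaussianLaw I := by
    have h := (hX.hasGaussianLaw I).aemeasurable
    constructor
    have : (fun ω ↦ I.restrict fun t ↦ (X t ∘ f) ω) = (fun ω ↦ I.restrict (X · ω)) ∘ f := rfl
    rw [this, ← AEMeasurable.map_map_of_aemeasurable (by rwa [hf.map_eq]) hf.aemeasurable,
      hf.map_eq]
    exact (hX.hasGaussianLaw I).isGaussian_map

/-- The sum of Gaussian processes on the two factors of a product space is a Gaussian process. -/
theorem IsGaussianProcess.add_prod {P : Measure Ω} {Q : Measure Ω'}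
    {X : T → Ω → ℝ} {Y : T → Ω' → ℝ} (hX : IsGaussianProcess X P) (hY : IsGaussianProcess Y Q)
    (mX : ∀ t, Measurable (X t)) (mY : ∀ t, Measurable (Y t)) :
    IsGaussianProcess (fun t (z : Ω × Ω') ↦ X t z.1 + Y t z.2) (P.prod Q) where
  hasGaussianLaw I := by
    have hP := hX.isProbabilityMeasure
    have hQ := hY.isProbabilityMeasure
    have h1 := (hX.comp_measurePreserving (measurePreserving_fst (μ := P) (ν := Q))).hasGaussianLaw I
    have h2 := (hY.comp_measurePreserving (measurePreserving_snd (μ := P) (ν := Q))).hasGaussianLaw I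
    exact (IndepFun.hasGaussianLaw h1 h2
      (indepFun_prod (X := fun ω ↦ I.restrict (X · ω)) (Y := fun ω ↦ I.restrict (Y · ω))
        (by fun_prop) (by fun_prop))).fun_add

theorem integral_add_prod {P : Measure Ω} {Q : Measure Ω'} [IsProbabilityMeasure P]
    [IsProbabilityMeasure Q] {X : Ω → ℝ} {Y : Ω' → ℝ} (hX : Integrable X P)
    (hY : Integrable Y Q) :
    (∫ z, X z.1 + Y z.2 ∂(P.prod Q)) = P[X] + Q[Y] := by
  rw [integral_add (hX.comp_fst Q) (hY.comp_snd P), integral_fun_fst, integral_fun_snd]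
  simp

theorem covariance_add_prod {P : Measure Ω} {Q : Measure Ω'} [IsProbabilityMeasure P]
    [IsProbabilityMeasure Q] {X X' : Ω → ℝ} {Y Y' : Ω' → ℝ} (hX : MemLp X 2 P)
    (hX' : MemLp X' 2 P) (hY : MemLp Y 2 Q) (hY' : MemLp Y' 2 Q) :
    cov[fun z ↦ X z.1 + Y z.2, fun z ↦ X' z.1 + Y' z.2; P.prod Q] =
      cov[X, X'; P] + cov[Y, Y'; Q] := by
  have m1 := measurePreserving_fst (μ := P) (ν := Q)
  have m2 := measurePreserving_snd (μ := P) (ν := Q)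
  have a1 := hX.comp_measurePreserving m1
  have a2 := hX'.comp_measurePreserving m1
  have b1 := hY.comp_measurePreserving m2
  have b2 := hY'.comp_measurePreserving m2
  change cov[X ∘ Prod.fst + Y ∘ Prod.snd, X' ∘ Prod.fst + Y' ∘ Prod.snd; P.prod Q] = _
  rw [covariance_add_left a1 b1 (a2.add b2), covariance_add_right a1 a2 b2,
    covariance_add_right b1 a2 b2]
  have c1 : cov[X ∘ Prod.fst, Y' ∘ Prod.snd; P.prod Q] = 0 :=
    (indepFun_prod₀ hX.1.aemeasurable hY'.1.aemeasurable).covariance_eq_zero a1 b2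
  have c2 : cov[Y ∘ Prod.snd, X' ∘ Prod.fst; P.prod Q] = 0 :=
    (indepFun_prod₀ hX'.1.aemeasurable hY.1.aemeasurable).symm.covariance_eq_zero b1 a2
  rw [c1, c2]
  have d1 := m1.hasLaw.covariance_comp hX.1.aemeasurable hX'.1.aemeasurable
  have d2 := m2.hasLaw.covariance_comp hY.1.aemeasurable hY'.1.aemeasurable
  rw [d1, d2]
  ring

end ProbabilityTheory

/-! ### Experiments that determine each other through a randomized map -/

/-- The transition that sends `μ` to the law of `Φ (x, ω)`, where `x` has law `μ` and `ω` is
independent of `x` with law `P`. -/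
def Transition.ofRandomizedMap {𝒳 𝒴 Ω : Type*} [MeasurableSpace 𝒳] [MeasurableSpace 𝒴]
    [MeasurableSpace Ω] (P : Measure Ω) [IsProbabilityMeasure P] (Φ : 𝒳 × Ω → 𝒴)
    (hΦ : Measurable Φ) : Transition 𝒳 𝒴 where
  toLinearMap :=
    { toFun μ := ⟨((μ : Measure 𝒳).prod P).map Φ, inferInstance⟩
      map_add' μ ν := by
        apply Subtype.ext
        change (((μ : Measure 𝒳) + ν).prod P).map Φ =
          ((μ : Measure 𝒳).prod P).map Φ + ((ν : Measure 𝒳).prod P).map Φ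
        rw [Measure.add_prod, Measure.map_add _ _ hΦ]
      map_smul' c μ := by
        apply Subtype.ext
        change ((c • (μ : Measure 𝒳)).prod P).map Φ = c • ((μ : Measure 𝒳).prod P).map Φ
        rw [Measure.prod_smul_left, Measure.map_smul] }
  mass_map μ := by
    apply ENNReal.coe_injective
    rw [FiniteMeasure.ennreal_mass, FiniteMeasure.ennreal_mass]
    change ((μ : Measure 𝒳).prod P).map Φ Set.univ = (μ : Measure 𝒳) Set.univ
    rw [Measure.map_apply hΦ MeasurableSet.univ, Set.preimage_univ, ← Set.univ_prod_univ,
      Measure.prod_prod, measure_univ (μ := P), mul_one]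

theorem tvDistance_self {𝒴 : Type*} [MeasurableSpace 𝒴] (μ : FiniteMeasure 𝒴) :
    tvDistance μ μ = 0 := by
  simp [tvDistance, SignedMeasure.totalVariation_zero]

theorem deficiency_eq_zero_of_randomizedMap {Θ 𝒳 𝒴 Ω : Type*} [MeasurableSpace 𝒳]
    [MeasurableSpace 𝒴] [MeasurableSpace Ω] {E : Experiment Θ 𝒳} {F : Experiment Θ 𝒴}
    (P : Measure Ω) [IsProbabilityMeasure P] {Φ : 𝒳 × Ω → 𝒴} (hΦ : Measurable Φ)
    (h : ∀ θ, ((E θ : Measure 𝒳).prod P).map Φ = F θ) : deficiency E F = 0 := by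
  refine le_antisymm (iInf_le_of_le (.ofRandomizedMap P Φ hΦ) (iSup_le fun θ ↦ ?_)) zero_le
  have : (Transition.ofRandomizedMap P Φ hΦ).toLinearMap (E θ).toFiniteMeasure =
      (F θ).toFiniteMeasure := Subtype.ext (h θ)
  rw [this, tvDistance_self]

/-- Undoing `Φ` discards the auxiliary randomness and leaves the first marginal of the product. -/
theorem map_eq_of_map_prod_eq {𝒳 𝒴 Ω : Type*} [MeasurableSpace 𝒳] [MeasurableSpace 𝒴]
    [MeasurableSpace Ω] {μ : Measure 𝒳} {ν : Measure 𝒴} (P : Measure Ω) [IsProbabilityMeasure P]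
    {Φ : 𝒳 × Ω → 𝒴} (hΦ : Measurable Φ) (h : (μ.prod P).map Φ = ν) {f : 𝒴 → 𝒳}
    (hf : Measurable f) (hfΦ : ∀ z, f (Φ z) = z.1) : ν.map f = μ := by
  rw [← h, Measure.map_map hf hΦ]
  have : f ∘ Φ = Prod.fst := funext hfΦ
  rw [this, Measure.map_fst_prod, measure_univ, one_smul]

/-- If `F` is obtained from `E` by a randomized map `Φ`, and `Φ` can be undone by `f`, then `E` and
`F` are equivalent. -/
theorem leCamDist_eq_zero_of_randomizedMap {Θ 𝒳 𝒴 Ω : Type*} [MeasurableSpace 𝒳]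
    [MeasurableSpace 𝒴] [MeasurableSpace Ω] {E : Experiment Θ 𝒳} {F : Experiment Θ 𝒴}
    (P : Measure Ω) [IsProbabilityMeasure P] {Φ : 𝒳 × Ω → 𝒴} (hΦ : Measurable Φ)
    (h : ∀ θ, ((E θ : Measure 𝒳).prod P).map Φ = F θ) {f : 𝒴 → 𝒳} (hf : Measurable f)
    (hfΦ : ∀ z, f (Φ z) = z.1) : leCamDist E F = 0 := by
  have hEF := deficiency_eq_zero_of_randomizedMap P hΦ h
  have hFE : deficiency F E = 0 := by
    -- The map back is deterministic: its auxiliary randomness lives on a one-point space.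
    refine deficiency_eq_zero_of_randomizedMap (Measure.dirac ()) (Φ := f ∘ Prod.fst)
      (hf.comp measurable_fst) fun θ ↦ ?_
    rw [← Measure.map_map hf measurable_fst, Measure.map_fst_prod, measure_univ, one_smul,
      map_eq_of_map_prod_eq P hΦ (h θ) hf hfΦ]
  rw [leCamDist, hEF, hFE, max_self]

/-- If `Φ` is a randomized map that can be undone by `f`, then the density of the image of `μ` with
respect to the image of `μ₀` is the density of `μ` with respect to `μ₀` composed with `f`. -/
theorem rnDeriv_map_prod_comp {𝒳 𝒴 Ω : Type*} [MeasurableSpace 𝒳] [MeasurableSpace 𝒴]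
    [MeasurableSpace Ω] (μ μ₀ : Measure 𝒳) [IsFiniteMeasure μ] [IsFiniteMeasure μ₀]
    (P : Measure Ω) [IsProbabilityMeasure P] {Φ : 𝒳 × Ω → 𝒴} (hΦ : Measurable Φ) {f : 𝒴 → 𝒳}
    (hf : Measurable f) (hfΦ : ∀ z, f (Φ z) = z.1) :
    ((μ.prod P).map Φ).rnDeriv ((μ₀.prod P).map Φ)
      =ᵐ[(μ₀.prod P).map Φ] μ.rnDeriv μ₀ ∘ f := by
  have hr := Measure.measurable_rnDeriv μ μ₀
  symm
  -- The image of the Lebesgue decomposition of `μ` is a Lebesgue decomposition of the image of `μ`: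
  -- preimages under `f` of separating sets still separate, and the density factors through `f`.
  refine Measure.eq_rnDeriv (s := ((μ.singularPart μ₀).prod P).map Φ) (hr.comp hf) ?_ ?_
  · obtain ⟨s, hs, h1, h2⟩ := Measure.mutuallySingular_singularPart μ μ₀
    have key (ν : Measure 𝒳) [SFinite ν] (t : Set 𝒳) (ht : MeasurableSet t) :
        ((ν.prod P).map Φ) (f ⁻¹' t) = ν t := by
      rw [Measure.map_apply hΦ (hf ht)]
      have : Φ ⁻¹' (f ⁻¹' t) = t ×ˢ Set.univ := by ext z; simp [hfΦ]
      rw [this, Measure.prod_prod]; simp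
    refine ⟨f ⁻¹' s, hf hs, ?_, ?_⟩
    · rw [key _ _ hs, h1]
    · rw [← Set.preimage_compl, key _ _ hs.compl, h2]
  · have h3 : ((μ₀.prod P).map Φ).withDensity (μ.rnDeriv μ₀ ∘ f) =
        ((μ₀.withDensity (μ.rnDeriv μ₀)).prod P).map Φ := by
      rw [prod_withDensity_left hr]
      ext s hs
      rw [withDensity_apply _ hs, Measure.map_apply hΦ hs, withDensity_apply _ (hΦ hs),
        setLIntegral_map hs (hr.comp hf) hΦ]
      simp [hfΦ]
    rw [h3, ← Measure.map_add _ _ hΦ, ← Measure.add_prod, ← Measure.haveLebesgueDecomposition_add]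

/-- Almost surely, the ratios of `F` are those of `E` evaluated at `f y`, and `f` carries `F θ₀` to
`E θ₀`. -/
theorem llrLaw_eq_of_randomizedMap {Θ 𝒳 𝒴 Ω : Type*} [MeasurableSpace 𝒳]
    [MeasurableSpace 𝒴] [MeasurableSpace Ω] {E : Experiment Θ 𝒳} {F : Experiment Θ 𝒴}
    (P : Measure Ω) [IsProbabilityMeasure P] {Φ : 𝒳 × Ω → 𝒴} (hΦ : Measurable Φ)
    (h : ∀ θ, ((E θ : Measure 𝒳).prod P).map Φ = F θ) {f : 𝒴 → 𝒳} (hf : Measurable f)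
    (hfΦ : ∀ z, f (Φ z) = z.1) (θ₀ : Θ) {n : ℕ} (θ : Fin n → Θ) :
    llrLaw E θ₀ θ = llrLaw F θ₀ θ := by
  have hfF : (F θ₀ : Measure 𝒴).map f = E θ₀ := map_eq_of_map_prod_eq P hΦ (h θ₀) hf hfΦ
  have hae : ∀ᵐ y ∂(F θ₀ : Measure 𝒴),
      (fun i ↦ llr (E (θ i) : Measure 𝒳) (E θ₀ : Measure 𝒳) (f y)) =
        fun i ↦ llr (F (θ i) : Measure 𝒴) (F θ₀ : Measure 𝒴) y := by
    have : ∀ᵐ y ∂(F θ₀ : Measure 𝒴), ∀ i, (F (θ i) : Measure 𝒴).rnDeriv (F θ₀ : Measure 𝒴) y =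
        (E (θ i) : Measure 𝒳).rnDeriv (E θ₀ : Measure 𝒳) (f y) := by
      refine ae_all_iff.2 fun i ↦ ?_
      rw [← h, ← h]
      exact rnDeriv_map_prod_comp _ _ P hΦ hf hfΦ
    filter_upwards [this] with y hy
    ext i
    simp [llr, hy i]
  rw [llrLaw, llrLaw, ← Measure.map_congr hae, ← hfF,
    Measure.map_map (measurable_pi_lambda _ fun i ↦ measurable_llr _ _) hf]
  rfl

/-! ### Random vectors and Brownian motions: moments and Gaussianity -/

section Moments

variable {Ω ι : Type*} [MeasurableSpace Ω] [Fintype ι] [DecidableEq ι] {P : Measure Ω}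

theorem HasLaw.integral_eval_multivariateGaussian {X : Ω → EuclideanSpace ℝ ι}
    {b : EuclideanSpace ℝ ι} {S : Matrix ι ι ℝ} (hX : HasLaw X (multivariateGaussian b S) P)
    (i : ι) : ∫ ω, X ω i ∂P = b i := by
  have h := hX.integral_comp (f := fun x : EuclideanSpace ℝ ι ↦ x i)
    (Measurable.aestronglyMeasurable (by fun_prop))
  have h2 := (EuclideanSpace.proj (𝕜 := ℝ) i).integral_comp_comm
    (IsGaussian.integrable_id (μ := multivariateGaussian b S))
  simp only [id_eq, integral_id_multivariateGaussian] at h2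
  exact h.trans h2

theorem HasLaw.covariance_eval_multivariateGaussian {X : Ω → EuclideanSpace ℝ ι}
    {b : EuclideanSpace ℝ ι} {S : Matrix ι ι ℝ} (hX : HasLaw X (multivariateGaussian b S) P)
    (hS : S.PosSemidef) (i j : ι) : cov[fun ω ↦ X ω i, fun ω ↦ X ω j; P] = S i j := by
  rw [hX.covariance_fun_comp (f := fun x ↦ x i) (g := fun x ↦ x j)
    (by fun_prop) (by fun_prop), ProbabilityTheory.covariance_eval_multivariateGaussian hS]

namespace IsBrownianMotionWithDrift

variable {W : unitInterval → Ω → EuclideanSpace ℝ ι} {b : EuclideanSpace ℝ ι} {S : Matrix ι ι ℝ}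

theorem hasLaw_eval (hW : IsBrownianMotionWithDrift W b S P) (u : unitInterval) :
    HasLaw (W u) (multivariateGaussian ((u : ℝ) • b) ((u : ℝ) • S)) P := by
  have h := hW.hasLaw_increment 0 u unitInterval.nonneg'
  simp only [Set.Icc.coe_zero, sub_zero] at h
  refine h.congr ?_
  filter_upwards [hW.start_zero] with ω hω
  simp [hω]

theorem isGaussianProcess (hW : IsBrownianMotionWithDrift W b S P) : IsGaussianProcess W P :=
  hW.indepIncrements.isGaussianProcess (fun u ↦ (hW.hasLaw_eval u).hasGaussianLaw) hW.start_zero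

theorem integral_eval (hW : IsBrownianMotionWithDrift W b S P) (u : unitInterval) (i : ι) :
    ∫ ω, W u ω i ∂P = u * b i := by
  simpa using HasLaw.integral_eval_multivariateGaussian (hW.hasLaw_eval u) i

theorem memLp_eval (hW : IsBrownianMotionWithDrift W b S P) (u : unitInterval) (i : ι) :
    MemLp (fun ω ↦ W u ω i) 2 P :=
  ((hW.hasLaw_eval u).hasGaussianLaw.map_fun (EuclideanSpace.proj (𝕜 := ℝ) i)).memLp_two

/-- Split `W v` into `W u` and the increment after `u`. Since the process starts at `0`, `W u` is
independent of that increment, so only the covariance of `W u` contributes. -/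
theorem covariance_eval_of_le (hW : IsBrownianMotionWithDrift W b S P) (hS : S.PosSemidef)
    {u v : unitInterval} (huv : u ≤ v) (i j : ι) :
    cov[fun ω ↦ W u ω i, fun ω ↦ W v ω j; P] = u * S i j := by
  have hP : IsProbabilityMeasure P := (hW.hasLaw_eval u).isProbabilityMeasure
  have h1 : (fun ω ↦ W v ω j) = (fun ω ↦ W u ω j) + fun ω ↦ W v ω j - W u ω j := by
    ext; simp
  have hi : IndepFun (fun ω ↦ W u ω i) (fun ω ↦ W v ω j - W u ω j) P :=
    (hW.indepIncrements.indepFun_eval_sub unitInterval.nonneg' huv hW.start_zero).comp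
      (φ := fun x : EuclideanSpace ℝ ι ↦ x i) (ψ := fun x : EuclideanSpace ℝ ι ↦ x j)
      (by fun_prop) (by fun_prop)
  have hd : MemLp (fun ω ↦ W v ω j - W u ω j) 2 P := (hW.memLp_eval v j).sub (hW.memLp_eval u j)
  rw [h1, covariance_add_right (hW.memLp_eval u i) (hW.memLp_eval u j) hd,
    hi.covariance_eq_zero (hW.memLp_eval u i) hd, add_zero,
    HasLaw.covariance_eval_multivariateGaussian (hW.hasLaw_eval u)
      (hS.smul (unitInterval.nonneg u))]
  simp

theorem covariance_eval (hW : IsBrownianMotionWithDrift W b S P) (hS : S.PosSemidef)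
    (u v : unitInterval) (i j : ι) :
    cov[fun ω ↦ W u ω i, fun ω ↦ W v ω j; P] = min (u : ℝ) v * S i j := by
  rcases le_total u v with h | h
  · rw [hW.covariance_eval_of_le hS h, min_eq_left (by exact_mod_cast h)]
  · rw [covariance_comm, hW.covariance_eval_of_le hS h, min_eq_right (by exact_mod_cast h)]
    -- Exchanging the times also exchanges the indices, so the symmetry of `S` is needed.
    simpa using congrArg ((v : ℝ) * ·) (hS.isHermitian.apply i j)

end IsBrownianMotionWithDrift

end Moments

/-! ### Coordinates -/

/-- Both experiments are specified only through vectors carrying all `k` coordinates of interest and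
a finite list of nuisance directions. Any finite set of coordinates sits inside such a vector, so
laws, means and covariances can be read off there. -/
theorem exists_enumeration {k : ℕ} {Υ : Type*} (A : Finset (Fin k ⊕ Υ)) :
    ∃ (ℓ : ℕ) (ηs : Fin ℓ → Υ), ∀ c ∈ A, ∃ a : Fin k ⊕ Fin ℓ, Sum.map id ηs a = c := by
  refine ⟨A.toRight.card, fun a ↦ A.toRight.equivFin.symm a, ?_⟩
  rintro (i | η) hc
  · exact ⟨Sum.inl i, rfl⟩
  · exact ⟨Sum.inr (A.toRight.equivFin ⟨η, by simpa using hc⟩), by simp⟩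

theorem exists_enumeration_pair {k : ℕ} {Υ : Type*} (c d : Fin k ⊕ Υ) :
    ∃ (ℓ : ℕ) (ηs : Fin ℓ → Υ) (a a' : Fin k ⊕ Fin ℓ),
      Sum.map id ηs a = c ∧ Sum.map id ηs a' = d := by
  classical
  obtain ⟨ℓ, ηs, h⟩ := exists_enumeration {c, d}
  obtain ⟨a, ha⟩ := h c (by simp)
  obtain ⟨a', ha'⟩ := h d (by simp)
  exact ⟨ℓ, ηs, a, a', ha, ha'⟩

namespace Information

variable {k : ℕ} {Υ : Type*} (𝓘 : Information k Υ)

/-- The location of a single coordinate at the local parameter value `(τ, η)`. -/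
def coordMean (τ : Fin k → ℝ) (η : Υ) : Fin k ⊕ Υ → ℝ :=
  Sum.elim (𝓘.int *ᵥ τ + 𝓘.cross η) (fun η' ↦ 𝓘.cross η' ⬝ᵥ τ + 𝓘.nuis η' η)

/-- The covariance of two coordinates. -/
def coordCov : Matrix (Fin k ⊕ Υ) (Fin k ⊕ Υ) ℝ :=
  Matrix.fromBlocks 𝓘.int (Matrix.of fun i η ↦ 𝓘.cross η i)
    (Matrix.of fun η j ↦ 𝓘.cross η j) (Matrix.of 𝓘.nuis)

theorem mean_apply (τ : Fin k → ℝ) (η : Υ) {ℓ : ℕ} (ηs : Fin ℓ → Υ) (a : Fin k ⊕ Fin ℓ) :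
    𝓘.mean τ η ηs a = 𝓘.coordMean τ η (Sum.map id ηs a) := by
  cases a <;> rfl

theorem cov_apply {ℓ : ℕ} (ηs : Fin ℓ → Υ) (a a' : Fin k ⊕ Fin ℓ) :
    𝓘.cov ηs a a' = 𝓘.coordCov (Sum.map id ηs a) (Sum.map id ηs a') := by
  cases a <;> cases a' <;> rfl

end Information

section Equivalence

variable {k : ℕ} {Υ : Type*} {𝓘 : Information k Υ}

/-! ### Gaussianity and moments of the shift experiment -/

section Shift

variable {E : Experiment (LocalParam k Υ) (ShiftSpace k Υ)}

theorem IsGaussianShift.isGaussianProcess (hE : IsGaussianShift 𝓘 E) (τ : Fin k → ℝ) (η : Υ) :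
    IsGaussianProcess (fun (c : Fin k ⊕ Υ) (x : ShiftSpace k Υ) ↦ x c) (E (τ, η) : Measure _) where
  hasGaussianLaw I := by
    obtain ⟨ℓ, ηs, h⟩ := exists_enumeration I
    choose f hf using h
    have := (hE τ η ℓ ηs).hasGaussianLaw.map_fun
      (ContinuousLinearMap.pi fun c : I ↦ EuclideanSpace.proj (𝕜 := ℝ) (f c.1 c.2))
    refine this.congr (.of_forall fun x ↦ funext fun c ↦ ?_)
    simp [marginal, hf]

theorem IsGaussianShift.integral_eval (hE : IsGaussianShift 𝓘 E) (τ : Fin k → ℝ) (η : Υ)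
    (c : Fin k ⊕ Υ) : ∫ x, x c ∂(E (τ, η) : Measure (ShiftSpace k Υ)) = 𝓘.coordMean τ η c := by
  obtain ⟨ℓ, ηs, a, -, rfl, -⟩ := exists_enumeration_pair c c
  rw [← Information.mean_apply]
  exact HasLaw.integral_eval_multivariateGaussian (hE τ η ℓ ηs) a

theorem IsGaussianShift.covariance_eval [Zero Υ] (h𝓘 : 𝓘.IsAdmissible)
    (hE : IsGaussianShift 𝓘 E) (τ : Fin k → ℝ) (η : Υ) (c d : Fin k ⊕ Υ) :
    cov[fun x ↦ x c, fun x ↦ x d; (E (τ, η) : Measure (ShiftSpace k Υ))] = 𝓘.coordCov c d := by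
  obtain ⟨ℓ, ηs, a, a', rfl, rfl⟩ := exists_enumeration_pair c d
  rw [← Information.cov_apply]
  exact HasLaw.covariance_eval_multivariateGaussian (hE τ η ℓ ηs) (h𝓘.posSemidef ℓ ηs) a a'

end Shift

/-! ### Paths of the drift experiment and their bridges -/

section Drift

variable {F : Experiment (LocalParam k Υ) (DriftSpace k Υ)}

/-- The evaluation of the path of the coordinate `p.1` at time `p.2`. -/
def pathEval (p : (Fin k ⊕ Υ) × unitInterval) (ω : DriftSpace k Υ) : ℝ := ω.1 p.1 p.2

theorem measurable_pathEval (p : (Fin k ⊕ Υ) × unitInterval) :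
    Measurable (pathEval p : DriftSpace k Υ → ℝ) :=
  (measurable_pi_apply p.2).comp ((measurable_pi_apply p.1).comp measurable_subtype_coe)

theorem IsBrownianDrift.isGaussianProcess (hF : IsBrownianDrift 𝓘 F) (τ : Fin k → ℝ) (η : Υ) :
    IsGaussianProcess (pathEval (k := k) (Υ := Υ)) (F (τ, η) : Measure _) where
  hasGaussianLaw I := by
    classical
    obtain ⟨ℓ, ηs, h⟩ := exists_enumeration (I.image Prod.fst)
    have h' (p : I) : ∃ a : Fin k ⊕ Fin ℓ, Sum.map id ηs a = p.1.1 :=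
      h _ (Finset.mem_image_of_mem _ p.2)
    choose f hf using h'
    have hW := hF τ η ℓ ηs
    -- Enlarge `I` to a grid of coordinates and times, where the process is jointly Gaussian, then
    -- project linearly.
    have := (hW.isGaussianProcess.hasGaussianLaw (I.image Prod.snd)).map_fun
      (ContinuousLinearMap.pi fun p : I ↦ (EuclideanSpace.proj (𝕜 := ℝ) (f p)).comp
        (ContinuousLinearMap.proj ⟨p.1.2, Finset.mem_image_of_mem _ p.2⟩))
    refine this.congr (.of_forall fun ω ↦ funext fun p ↦ ?_)
    simp [marginal, hf, pathEval]

theorem IsBrownianDrift.integral_pathEval (hF : IsBrownianDrift 𝓘 F) (τ : Fin k → ℝ) (η : Υ)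
    (p : (Fin k ⊕ Υ) × unitInterval) :
    ∫ ω, pathEval p ω ∂(F (τ, η) : Measure (DriftSpace k Υ)) = p.2 * 𝓘.coordMean τ η p.1 := by
  obtain ⟨c, u⟩ := p
  obtain ⟨ℓ, ηs, a, -, rfl, -⟩ := exists_enumeration_pair c c
  rw [← Information.mean_apply]
  exact (hF τ η ℓ ηs).integral_eval u a

theorem IsBrownianDrift.covariance_pathEval [Zero Υ] (h𝓘 : 𝓘.IsAdmissible)
    (hF : IsBrownianDrift 𝓘 F) (τ : Fin k → ℝ) (η : Υ) (p q : (Fin k ⊕ Υ) × unitInterval) :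
    cov[pathEval p, pathEval q; (F (τ, η) : Measure (DriftSpace k Υ))] =
      min (p.2 : ℝ) q.2 * 𝓘.coordCov p.1 q.1 := by
  obtain ⟨c, u⟩ := p
  obtain ⟨d, v⟩ := q
  obtain ⟨ℓ, ηs, a, a', rfl, rfl⟩ := exists_enumeration_pair c d
  rw [← Information.cov_apply]
  exact (hF τ η ℓ ηs).covariance_eval (h𝓘.posSemidef ℓ ηs) u v a a'

/-- The value at time `p.2` of the bridge obtained from the path of the coordinate `p.1`. -/
def bridgeEval (p : (Fin k ⊕ Υ) × unitInterval) (ω : DriftSpace k Υ) : ℝ :=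
  pathEval p ω - p.2 * pathEval (p.1, 1) ω

theorem measurable_bridgeEval (p : (Fin k ⊕ Υ) × unitInterval) :
    Measurable (bridgeEval p : DriftSpace k Υ → ℝ) :=
  (measurable_pathEval p).sub ((measurable_pathEval _).const_mul _)

theorem IsBrownianDrift.isGaussianProcess_bridgeEval (hF : IsBrownianDrift 𝓘 F)
    (τ : Fin k → ℝ) (η : Υ) :
    IsGaussianProcess (bridgeEval (k := k) (Υ := Υ)) (F (τ, η) : Measure _) := by
  classical
  have hG := hF.isGaussianProcess τ η
  refine hG.of_isGaussianProcess fun p ↦ ⟨{p, (p.1, 1)},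
    ContinuousLinearMap.proj ⟨p, by simp⟩ -
      (p.2 : ℝ) • ContinuousLinearMap.proj ⟨(p.1, 1), by simp⟩, fun ω ↦ ?_⟩
  simp [bridgeEval]

theorem IsBrownianDrift.memLp_pathEval (hF : IsBrownianDrift 𝓘 F) (τ : Fin k → ℝ) (η : Υ)
    (p : (Fin k ⊕ Υ) × unitInterval) : MemLp (pathEval p) 2 (F (τ, η) : Measure _) :=
  ((hF.isGaussianProcess τ η).hasGaussianLaw_eval p).memLp_two

theorem IsBrownianDrift.integral_bridgeEval (hF : IsBrownianDrift 𝓘 F) (τ : Fin k → ℝ) (η : Υ)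
    (p : (Fin k ⊕ Υ) × unitInterval) :
    ∫ ω, bridgeEval p ω ∂(F (τ, η) : Measure (DriftSpace k Υ)) = 0 := by
  have hi (q) := (hF.memLp_pathEval τ η q).integrable one_le_two
  simp only [bridgeEval]
  rw [integral_sub (hi p) ((hi _).const_mul _), integral_const_mul, hF.integral_pathEval,
    hF.integral_pathEval]
  simp

/-- The right side does not involve `(τ, η)`: with the zero mean and Gaussianity, this makes the
bridges ancillary. -/
theorem IsBrownianDrift.covariance_bridgeEval [Zero Υ] (h𝓘 : 𝓘.IsAdmissible)
    (hF : IsBrownianDrift 𝓘 F) (τ : Fin k → ℝ) (η : Υ) (p q : (Fin k ⊕ Υ) × unitInterval) :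
    cov[bridgeEval p, bridgeEval q; (F (τ, η) : Measure (DriftSpace k Υ))] =
      (min (p.2 : ℝ) q.2 - p.2 * q.2) * 𝓘.coordCov p.1 q.1 := by
  have h (r) := hF.memLp_pathEval τ η r
  change cov[fun ω ↦ pathEval p ω - p.2 * pathEval (p.1, 1) ω,
    fun ω ↦ pathEval q ω - q.2 * pathEval (q.1, 1) ω; _] = _
  rw [covariance_fun_sub_fun_sub (h p) ((h _).const_mul _) (h q) ((h _).const_mul _),
    covariance_const_mul_left, covariance_const_mul_left, covariance_const_mul_right,
    covariance_const_mul_right]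
  simp only [hF.covariance_pathEval h𝓘, Set.Icc.coe_one, min_self,
    min_eq_left (unitInterval.le_one p.2), min_eq_right (unitInterval.le_one q.2)]
  ring

/-- Two measures on the space of paths are equal if the evaluations of the paths have the
same joint law. -/
theorem DriftSpace.measure_ext {μ ν : Measure (DriftSpace k Υ)}
    (h : μ.map (fun ω p ↦ pathEval p ω) = ν.map (fun ω p ↦ pathEval p ω)) : μ = ν := by
  have hm : Measurable fun (ω : DriftSpace k Υ) p ↦ pathEval p ω :=
    measurable_pi_lambda _ measurable_pathEval
  ext s hs
  -- The σ-field on a subtype consists of preimages under the coercion, which is `pathEval` followed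
  -- by the currying map `e`.
  obtain ⟨t, ht, rfl⟩ := hs
  let e : ((Fin k ⊕ Υ) × unitInterval → ℝ) → Fin k ⊕ Υ → unitInterval → ℝ := fun x c u ↦ x (c, u)
  have he : Measurable e :=
    measurable_pi_lambda _ fun c ↦ measurable_pi_lambda _ fun u ↦ measurable_pi_apply (c, u)
  have := congrArg (· (e ⁻¹' t)) h
  simp only [Measure.map_apply hm (he ht)] at this
  exact this

end Drift

/-! ### The randomized map from the shift to the drift experiment -/

/-- The paths with value `z.1` at time `1` whose bridges are those of `z.2`. -/
def addBridge (z : ShiftSpace k Υ × DriftSpace k Υ) : DriftSpace k Υ :=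
  ⟨fun c u ↦ u * z.1 c + bridgeEval (c, u) z.2, fun c ↦ by
    have := z.2.2 c
    simp only [bridgeEval, pathEval]
    fun_prop⟩

theorem measurable_addBridge : Measurable (addBridge (k := k) (Υ := Υ)) := by
  refine Measurable.subtype_mk (measurable_pi_lambda _ fun c ↦ measurable_pi_lambda _ fun u ↦ ?_)
  exact (((measurable_pi_apply c).comp measurable_fst).const_mul _).add
    ((measurable_bridgeEval (c, u)).comp measurable_snd)

theorem pathEval_addBridge (p : (Fin k ⊕ Υ) × unitInterval)
    (z : ShiftSpace k Υ × DriftSpace k Υ) :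
    pathEval p (addBridge z) = p.2 * z.1 p.1 + bridgeEval p z.2 := rfl

/-- The endpoints of the paths. -/
def endpoint (ω : DriftSpace k Υ) : ShiftSpace k Υ := fun c ↦ pathEval (c, 1) ω

theorem measurable_endpoint : Measurable (endpoint (k := k) (Υ := Υ)) :=
  measurable_pi_lambda _ fun _ ↦ measurable_pathEval _

theorem endpoint_addBridge (z : ShiftSpace k Υ × DriftSpace k Υ) :
    endpoint (addBridge z) = z.1 := by
  ext c
  simp [endpoint, pathEval_addBridge, bridgeEval]

/-- The independent endpoint restores the covariance `u * v` that the bridge lacks, and it carries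
the whole drift. -/
theorem map_addBridge_eq [Zero Υ] (h𝓘 : 𝓘.IsAdmissible)
    {E : Experiment (LocalParam k Υ) (ShiftSpace k Υ)} (hE : IsGaussianShift 𝓘 E)
    {F : Experiment (LocalParam k Υ) (DriftSpace k Υ)} (hF : IsBrownianDrift 𝓘 F)
    (θ : LocalParam k Υ) :
    ((E θ : Measure (ShiftSpace k Υ)).prod (F (0, 0) : Measure (DriftSpace k Υ))).map addBridge =
      F θ := by
  obtain ⟨τ, η⟩ := θ
  apply DriftSpace.measure_ext
  rw [Measure.map_map (measurable_pi_lambda _ measurable_pathEval) measurable_addBridge]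
  have hX : IsGaussianProcess
      (fun (p : (Fin k ⊕ Υ) × unitInterval) (x : ShiftSpace k Υ) ↦ (p.2 : ℝ) * x p.1)
      (E (τ, η) : Measure _) :=
    ((hE.isGaussianProcess τ η).comp_right Prod.fst).smul
      fun p : (Fin k ⊕ Υ) × unitInterval ↦ (p.2 : ℝ)
  have hB := hF.isGaussianProcess_bridgeEval 0 0
  have mX (p : (Fin k ⊕ Υ) × unitInterval) :
      Measurable fun x : ShiftSpace k Υ ↦ (p.2 : ℝ) * x p.1 := by fun_prop
  have lX (p) := (hX.hasGaussianLaw_eval p).memLp_two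
  have lB (p) := (hB.hasGaussianLaw_eval p).memLp_two
  refine (hX.add_prod hB mX measurable_bridgeEval).map_eq_of_mean_of_cov
    (hF.isGaussianProcess τ η) (fun p ↦ ?_) measurable_pathEval (fun p ↦ ?_) fun p q ↦ ?_
  · exact ((mX p).comp measurable_fst).add ((measurable_bridgeEval p).comp measurable_snd)
  · rw [integral_add_prod ((lX p).integrable one_le_two) ((lB p).integrable one_le_two),
      integral_const_mul, hE.integral_eval, hF.integral_bridgeEval, hF.integral_pathEval, add_zero]
  · rw [covariance_add_prod (lX p) (lX q) (lB p) (lB q), covariance_const_mul_left,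
      covariance_const_mul_right, hE.covariance_eval h𝓘, hF.covariance_bridgeEval h𝓘,
      hF.covariance_pathEval h𝓘]
    ring

end Equivalence

theorem mainTheorem5 {k : ℕ} {Υ : Type*} [AddCommGroup Υ] [Module ℝ Υ]
    (𝓘 : Information k Υ) (h𝓘 : 𝓘.IsAdmissible)
    (E : Experiment (LocalParam k Υ) (ShiftSpace k Υ)) (hE : IsGaussianShift 𝓘 E)
    (F : Experiment (LocalParam k Υ) (DriftSpace k Υ)) (hF : IsBrownianDrift 𝓘 F) :
    leCamDist E F = 0 ∧
      ∀ (n : ℕ) (θ : Fin n → LocalParam k Υ), llrLaw E (0, 0) θ = llrLaw F (0, 0) θ :=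
  have h := map_addBridge_eq h𝓘 hE hF
  ⟨leCamDist_eq_zero_of_randomizedMap _ measurable_addBridge h measurable_endpoint
    endpoint_addBridge, fun _ θ ↦ llrLaw_eq_of_randomizedMap _ measurable_addBridge h
      measurable_endpoint endpoint_addBridge _ θ⟩

end
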